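/- Let $n\ge 0$ be an integer, let $q, x_0,\dots,x_n$ be independent indeterminates, and for a nonnegative integer $m$ put $(z)_m=(1-z)(1-qz)\cdots(1-q^{m-1}z)$, with $(z)_0=1$. Then for all nonnegative integers $a_0,a_1,\dots,a_n$, $$\mathop{\mathrm{CT}}_{x_0,\dots,x_n}\ \prod_{0\le i<j\le n}\left(\frac{x_i}{x_j}\right)_{a_i}\left(\frac{x_j}{x_i}\,q\right)_{a_j}=\frac{(q)_{a_0+a_1+\cdots+a_n}}{(q)_{a_0}(q)_{a_1}\cdots(q)_{a_n}},$$ where $\mathrm{CT}_{x_0,\dots,x_n}$ denotes the constant term in $x_0,\dots,x_n$, that is, the coefficient of $x_0^0x_1^0\cdots x_n^0$ of a Laurent polynomial over $\mathbb{C}(q)$. -/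

import Mathlib

/-- The `q`-shifted factorial `(z)_m = (1 - z) (1 - q z) ⋯ (1 - q ^ (m - 1) z)`, in any
commutative ring. -/
def qShiftedFactorial {R : Type*} [CommRing R] (q z : R) (m : ℕ) : R :=
  ∏ k ∈ Finset.range m, (1 - q ^ k * z)

/-- The coefficient field `K = ℂ(q)`, with `q` an indeterminate. -/
abbrev QField : Type := RatFunc ℂ

/-- The indeterminate `q` of `ℂ(q)`. -/
noncomputable def qVar : QField := RatFunc.X

/-- The ring `K[x_0, x_0⁻¹, …, x_n, x_n⁻¹]` of Laurent polynomials in `x_0, …, x_n` over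
`K = ℂ(q)`: the exponent of a monomial is a vector in `ℤ ^ (n + 1)`. -/
abbrev LaurentRing (n : ℕ) : Type := AddMonoidAlgebra QField (Fin (n + 1) → ℤ)

/-- The power `x_i ^ k` of a variable, for an integer `k`. -/
noncomputable def laurentVarPow {n : ℕ} (i : Fin (n + 1)) (k : ℤ) : LaurentRing n :=
  AddMonoidAlgebra.single (Pi.single i k) 1

/-- The Laurent monomial `x_i / x_j = x_i x_j⁻¹`. -/
noncomputable def varRatio {n : ℕ} (i j : Fin (n + 1)) : LaurentRing n :=
  laurentVarPow i 1 * laurentVarPow j (-1)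

/-- The indeterminate `q`, as a constant of the Laurent polynomial ring. -/
noncomputable def qConst (n : ℕ) : LaurentRing n :=
  algebraMap QField (LaurentRing n) qVar

/-- The constant term in `x_0, …, x_n`: the coefficient of `x_0 ^ 0 ⋯ x_n ^ 0`. -/
noncomputable def constantTerm {n : ℕ} (f : LaurentRing n) : QField :=
  f.coeff 0

/-! Lagrange interpolation replaces the constant term by a weighted sum of values on a grid, and all
but one of these values vanish. The product is homogeneous of degree 0, and its exponent of `x_i` is
at least `-d_i`, where `d_i = ∑ a - a_i`. Evaluating at `x_i = q ^ α_i` with `0 ≤ α_i ≤ d_i` and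
weighting by leading-coefficient interpolation therefore recovers the constant term
(`constantTerm_eq_sum_laurentEval`).

At a grid point where no factor vanishes, the `α_i` are far apart, and the bounds `d_i` leave just
enough room for them in their natural order: `α_i = a_0 + ⋯ + a_{i-1}` (`eq_partialSum_of_gaps`).
The value there, times its weight, telescopes to the right-hand side
(`prod_pairs_mul_prod_geometricWeight`). -/

open Finset

/-! ### Lagrange interpolation at powers of `q`. -/

section Interpolation

variable {K : Type*} [Field K]

/-- The Lagrange weight at the node `q ^ p` among the nodes `1, q, …, q ^ d`, normalised so that
it pairs with Laurent monomials of degree between `-d` and `0`. -/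
noncomputable def geometricWeight (q : K) (d p : ℕ) : K :=
  ∏ s ∈ (range (d + 1)).erase p, (1 - q ^ ((s : ℤ) - p))⁻¹

theorem zpow_ne_one_of_pow_ne_one {q : K} (hq : ∀ k : ℕ, 0 < k → q ^ k ≠ 1) {z : ℤ} (hz : z ≠ 0) :
    q ^ z ≠ 1 := by
  obtain ⟨k, rfl | rfl⟩ := z.eq_nat_or_neg
  · simpa using hq k (by lia)
  · simpa using hq k (by lia)

/-- With `m = k - d`, the sum is the Lagrange formula for the coefficient of `X ^ d` in `X ^ k`, on
`d + 1` nodes. -/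
theorem sum_geometricWeight_mul_zpow {q : K} (hq0 : q ≠ 0) (hq : ∀ k : ℕ, 0 < k → q ^ k ≠ 1)
    (d : ℕ) {m : ℤ} (hm : -(d : ℤ) ≤ m) (hm0 : m ≤ 0) :
    ∑ p ∈ range (d + 1), geometricWeight q d p * q ^ ((p : ℤ) * m) = if m = 0 then 1 else 0 := by
  obtain ⟨k, hk⟩ : ∃ k : ℕ, m = (k : ℤ) - d := ⟨(m + d).toNat, by lia⟩
  have hinj : Set.InjOn (fun p : ℕ ↦ q ^ p) (range (d + 1)) := by
    intro x _ y _ hxy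
    by_contra hne
    refine zpow_ne_one_of_pow_ne_one hq (z := (x : ℤ) - y) (by lia) ?_
    rw [zpow_sub₀ hq0]
    simp only [zpow_natCast]
    simp only at hxy
    rw [hxy, div_self (pow_ne_zero _ hq0)]
  have key := Lagrange.coeff_eq_sum hinj (P := (Polynomial.X : Polynomial K) ^ k) (by
    rw [Polynomial.degree_X_pow, card_range]
    exact_mod_cast (by lia : k < d + 1))
  rw [Polynomial.coeff_X_pow, card_range, Nat.add_sub_cancel] at key
  have hif : (if m = 0 then (1 : K) else 0) = if d = k then 1 else 0 := by
    congr 1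
    exact propext ⟨fun h ↦ by lia, fun h ↦ by lia⟩
  rw [hif, key]
  refine sum_congr rfl fun p hp ↦ ?_
  have hprod : ∏ s ∈ (range (d + 1)).erase p, (q ^ p - q ^ s) =
      q ^ (p * d) * ∏ s ∈ (range (d + 1)).erase p, (1 - q ^ ((s : ℤ) - p)) := by
    have hcard : (q ^ p) ^ d = ∏ _s ∈ (range (d + 1)).erase p, q ^ p := by
      rw [prod_const, card_erase_of_mem hp, card_range, Nat.add_sub_cancel]
    rw [pow_mul, hcard, ← prod_mul_distrib]
    refine prod_congr rfl fun s _ ↦ ?_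
    rw [zpow_sub₀ hq0, zpow_natCast, zpow_natCast]
    field_simp
  rw [hprod, geometricWeight, prod_inv_distrib, Polynomial.eval_pow, Polynomial.eval_X, hk,
    mul_sub, zpow_sub₀ hq0, div_eq_mul_inv, div_eq_mul_inv, mul_inv, ← pow_mul]
  norm_cast
  ring

end Interpolation

/-! ### The constant term as a weighted sum over a grid. -/

section ConstantTerm

variable {n : ℕ}

theorem qVar_ne_zero : qVar ≠ 0 := RatFunc.X_ne_zero

theorem qVar_pow_ne_one (k : ℕ) (hk : 0 < k) : qVar ^ k ≠ 1 := by
  intro h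
  have h' : algebraMap (Polynomial ℂ) (RatFunc ℂ) (Polynomial.X ^ k) =
      algebraMap (Polynomial ℂ) (RatFunc ℂ) 1 := by
    rw [map_pow, RatFunc.algebraMap_X, map_one]
    exact h
  have := congrArg Polynomial.natDegree (RatFunc.algebraMap_injective ℂ h')
  rw [Polynomial.natDegree_X_pow, Polynomial.natDegree_one] at this
  lia

/-- Evaluation of a Laurent polynomial at `x_i = q ^ α_i`. -/
noncomputable def laurentEval (α : Fin (n + 1) → ℤ) : LaurentRing n →ₐ[QField] QField :=
  AddMonoidAlgebra.lift QField QField (Fin (n + 1) → ℤ)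
    { toFun := fun m ↦ qVar ^ ∑ i, α i * m.toAdd i
      map_one' := by simp
      map_mul' := fun x y ↦ by
        simp [mul_add, sum_add_distrib, zpow_add₀ qVar_ne_zero] }

theorem laurentEval_single (α m : Fin (n + 1) → ℤ) (c : QField) :
    laurentEval α (AddMonoidAlgebra.single m c) = c * qVar ^ ∑ i, α i * m i := by
  rw [laurentEval, AddMonoidAlgebra.lift_single]
  rfl

theorem laurentEval_eq_sum (α : Fin (n + 1) → ℤ) (f : LaurentRing n) :
    laurentEval α f = ∑ m ∈ f.coeff.support, f.coeff m * qVar ^ ∑ i, α i * m i := by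
  rw [laurentEval, AddMonoidAlgebra.lift_apply]
  rfl

/-- The Laurent polynomial `f` is homogeneous of degree `0`, and the exponent of `x_i` in it is
at least `-d_i`. -/
def IsHomogeneousWithPoles (d : Fin (n + 1) → ℕ) (f : LaurentRing n) : Prop :=
  ∀ m, f.coeff m ≠ 0 → ∑ i, m i = 0 ∧ ∀ i, -(d i : ℤ) ≤ m i

theorem IsHomogeneousWithPoles.one : IsHomogeneousWithPoles 0 (1 : LaurentRing n) := by
  classical
  intro m hm
  rw [AddMonoidAlgebra.one_def, AddMonoidAlgebra.coeff_single, Finsupp.single_apply] at hm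
  have : m = 0 := by
    by_contra h
    exact hm (if_neg (Ne.symm h))
  simp [this]

theorem IsHomogeneousWithPoles.mul {d e : Fin (n + 1) → ℕ} {f g : LaurentRing n}
    (hf : IsHomogeneousWithPoles d f) (hg : IsHomogeneousWithPoles e g) :
    IsHomogeneousWithPoles (d + e) (f * g) := by
  classical
  intro m hm
  obtain ⟨x, hx, y, hy, rfl⟩ := mem_add.1
    (AddMonoidAlgebra.support_coeff_mul_subset f g (Finsupp.mem_support_iff.2 hm))
  obtain ⟨hx0, hxd⟩ := hf x (Finsupp.mem_support_iff.1 hx)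
  obtain ⟨hy0, hye⟩ := hg y (Finsupp.mem_support_iff.1 hy)
  refine ⟨by simp [sum_add_distrib, hx0, hy0], fun i ↦ ?_⟩
  have := hxd i
  have := hye i
  simp only [Pi.add_apply]
  push_cast
  lia

theorem IsHomogeneousWithPoles.prod {ι : Type*} (s : Finset ι) {d : ι → Fin (n + 1) → ℕ}
    {f : ι → LaurentRing n} (h : ∀ k ∈ s, IsHomogeneousWithPoles (d k) (f k)) :
    IsHomogeneousWithPoles (∑ k ∈ s, d k) (∏ k ∈ s, f k) := by
  classical
  induction s using Finset.induction_on with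
  | empty => simpa using IsHomogeneousWithPoles.one
  | insert k s hk ih =>
    rw [prod_insert hk, sum_insert hk]
    exact (h k (mem_insert_self _ _)).mul (ih fun l hl ↦ h l (mem_insert_of_mem hl))

theorem varRatio_eq_single (i j : Fin (n + 1)) :
    varRatio i j = AddMonoidAlgebra.single (Pi.single i 1 + Pi.single j (-1)) 1 := by
  rw [varRatio, laurentVarPow, laurentVarPow, AddMonoidAlgebra.single_mul_single, one_mul]

theorem isHomogeneousWithPoles_one_sub (i j : Fin (n + 1)) (c : QField) :
    IsHomogeneousWithPoles (Pi.single j 1)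
      (1 - algebraMap QField (LaurentRing n) c * varRatio i j) := by
  classical
  intro m hm
  have hms : m = 0 ∨ m = Pi.single i 1 + Pi.single j (-1) := by
    by_contra! h
    apply hm
    rw [varRatio_eq_single, ← Algebra.smul_def, AddMonoidAlgebra.one_def,
      AddMonoidAlgebra.coeff_sub, AddMonoidAlgebra.coeff_smul]
    simp [Ne.symm h.1, Ne.symm h.2]
  rcases hms with rfl | rfl
  · simp
  · refine ⟨by simp [sum_add_distrib], fun k ↦ ?_⟩
    simp only [Pi.add_apply, Pi.single_apply]
    split_ifs <;> simp

/-- The shifts `b = 0` and `b = 1` cover the two kinds of factor in the Dyson product. -/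
theorem qShiftedFactorial_qConst_eq (i j : Fin (n + 1)) (a b : ℕ) :
    qShiftedFactorial (qConst n) (varRatio i j * qConst n ^ b) a =
      ∏ k ∈ range a,
        (1 - algebraMap QField (LaurentRing n) (qVar ^ (k + b)) * varRatio i j) := by
  refine prod_congr rfl fun k _ ↦ ?_
  rw [qConst, map_pow, pow_add]
  ring

theorem isHomogeneousWithPoles_qShiftedFactorial (i j : Fin (n + 1)) (a b : ℕ) :
    IsHomogeneousWithPoles (Pi.single j a)
      (qShiftedFactorial (qConst n) (varRatio i j * qConst n ^ b) a) := by
  rw [qShiftedFactorial_qConst_eq]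
  convert IsHomogeneousWithPoles.prod (range a)
    fun k _ ↦ isHomogeneousWithPoles_one_sub i j (qVar ^ (k + b)) using 1
  ext k
  simp [Pi.single_apply]

theorem laurentEval_qShiftedFactorial (α : Fin (n + 1) → ℤ) (i j : Fin (n + 1)) (a b : ℕ) :
    laurentEval α (qShiftedFactorial (qConst n) (varRatio i j * qConst n ^ b) a) =
      ∏ k ∈ range a, (1 - qVar ^ ((k : ℤ) + b + α i - α j)) := by
  rw [qShiftedFactorial_qConst_eq, map_prod]
  refine prod_congr rfl fun k _ ↦ ?_
  rw [map_sub, map_one, map_mul, AlgHom.commutes, varRatio_eq_single, laurentEval_single, one_mul,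
    Algebra.algebraMap_self_apply, ← zpow_natCast, ← zpow_add₀ qVar_ne_zero]
  congr 2
  simp [mul_add, sum_add_distrib, Pi.single_apply]
  ring

/-- The weighted sum factors over the variables. A nonzero exponent vector of total degree 0 has a
negative coordinate, whose factor is 0; positive coordinates, possibly outside the interpolation
range, do not matter. -/
theorem constantTerm_eq_sum_laurentEval {d : Fin (n + 1) → ℕ} {f : LaurentRing n}
    (hf : IsHomogeneousWithPoles d f) :
    constantTerm f = ∑ α ∈ Fintype.piFinset fun i ↦ range (d i + 1),
      (∏ i, geometricWeight qVar (d i) (α i)) * laurentEval (fun i ↦ (α i : ℤ)) f := by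
  classical
  have key : ∀ m ∈ f.coeff.support,
      ∑ α ∈ Fintype.piFinset fun i ↦ range (d i + 1),
        (∏ i, geometricWeight qVar (d i) (α i)) * qVar ^ ∑ i, (α i : ℤ) * m i =
      if m = 0 then 1 else 0 := by
    intro m hm
    obtain ⟨hm0, hmd⟩ := hf m (Finsupp.mem_support_iff.1 hm)
    have hzpow : ∀ g : Fin (n + 1) → ℤ, qVar ^ ∑ i, g i = ∏ i, qVar ^ g i := by
      intro g
      have : ∀ s : Finset (Fin (n + 1)), qVar ^ ∑ i ∈ s, g i = ∏ i ∈ s, qVar ^ g i := by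
        intro s
        induction s using Finset.induction_on with
        | empty => simp
        | insert i s hi ih => rw [sum_insert hi, prod_insert hi, zpow_add₀ qVar_ne_zero, ih]
      exact this _
    simp_rw [hzpow, ← prod_mul_distrib]
    rw [← prod_univ_sum (fun i ↦ range (d i + 1))
      fun i p ↦ geometricWeight qVar (d i) p * qVar ^ ((p : ℤ) * m i)]
    split_ifs with h
    · refine prod_eq_one fun i _ ↦ ?_
      rw [sum_geometricWeight_mul_zpow qVar_ne_zero qVar_pow_ne_one _ (hmd i) (by simp [h]),
        if_pos (by simp [h])]
    · obtain ⟨i, -, hi⟩ : ∃ i ∈ univ, m i < 0 := by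
        by_contra! hpos
        exact h (funext fun i ↦ (sum_eq_zero_iff_of_nonneg hpos).1 hm0 i (mem_univ i))
      refine prod_eq_zero (mem_univ i) ?_
      rw [sum_geometricWeight_mul_zpow qVar_ne_zero qVar_pow_ne_one _ (hmd i) hi.le,
        if_neg hi.ne]
  simp_rw [laurentEval_eq_sum, mul_sum]
  rw [sum_comm, constantTerm]
  have : ∀ m ∈ f.coeff.support, ∑ α ∈ Fintype.piFinset fun i ↦ range (d i + 1),
      (∏ i, geometricWeight qVar (d i) (α i)) * (f.coeff m * qVar ^ ∑ i, (α i : ℤ) * m i) =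
      if m = 0 then f.coeff 0 else 0 := by
    intro m hm
    simp_rw [mul_left_comm _ (f.coeff m)]
    rw [← mul_sum, key m hm]
    split_ifs with h <;> simp [h]
  rw [sum_congr rfl this, sum_ite_eq']
  split_ifs with h
  · rfl
  · exact Finsupp.notMem_support_iff.1 h

end ConstantTerm

/-! ### Rigidity of the surviving grid point. -/

/-- If integers `α_i ≥ 0` are bounded by `∑ a - a_i`, and whenever `α_j` follows `α_i` in the
order by `(α, index)` it exceeds it by at least `a_i`, strictly if `j < i`, then
`α_i = ∑_{j < i} a_j`. -/
theorem eq_partialSum_of_gaps {n : ℕ} (a α : Fin (n + 1) → ℕ)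
    (hle : ∀ i, α i + a i ≤ ∑ j, a j)
    (hlt : ∀ i j, i < j → α i ≤ α j → α i + a i ≤ α j)
    (hgt : ∀ i j, j < i → α i < α j → α i + a i < α j) (i : Fin (n + 1)) :
    α i = ∑ j ∈ Iio i, a j := by
  obtain ⟨hmono, hstable⟩ := (Tuple.eq_sort_iff (f := α) (σ := Tuple.sort α)).1 rfl
  set π := Tuple.sort α
  have hstep : ∀ k : Fin n, α (π k.castSucc) + a (π k.castSucc) ≤ α (π k.succ) ∧
      (π k.succ < π k.castSucc → α (π k.castSucc) + a (π k.castSucc) < α (π k.succ)) := by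
    intro k
    have h1 : α (π k.castSucc) ≤ α (π k.succ) := hmono k.castSucc_le_succ
    rcases lt_trichotomy (π k.castSucc) (π k.succ) with h | h | h
    · exact ⟨hlt _ _ h h1, fun h' ↦ absurd h' h.asymm⟩
    · exact absurd (π.injective h) (Fin.castSucc_lt_succ).ne
    · have h2 : α (π k.castSucc) < α (π k.succ) := by
        -- The sort is stable, so ties keep the order of indices and a descent of `π` excludes
        -- equality.
        refine lt_of_le_of_ne h1 fun he ↦ ?_
        exact h.asymm (hstable _ _ Fin.castSucc_lt_succ he)
      exact ⟨(hgt _ _ h h2).le, fun _ ↦ hgt _ _ h h2⟩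
  -- The slack over the tightest packing in sorted order: it is nondecreasing, starts nonnegative
  -- and ends nonpositive, hence is 0.
  let g : Fin (n + 1) → ℤ := fun k ↦ (α (π k) : ℤ) - ∑ l ∈ Iio k, (a (π l) : ℤ)
  have hIio : ∀ (b : Fin (n + 1) → ℤ) (k : Fin n),
      ∑ l ∈ Iio k.succ, b l = ∑ l ∈ Iio k.castSucc, b l + b k.castSucc := by
    intro b k
    have : Iio k.succ = insert k.castSucc (Iio k.castSucc) := by
      ext l
      simp only [mem_Iio, mem_insert, Fin.lt_def, Fin.ext_iff, Fin.val_succ, Fin.val_castSucc]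
      lia
    rw [this, sum_insert (by simp), add_comm]
  have hg : Monotone g := by
    refine Fin.monotone_iff_le_succ.2 fun k ↦ ?_
    have := (hstep k).1
    simp only [g, hIio]
    lia
  have hg0 : ∀ k, g k = 0 := by
    intro k
    have h0 : 0 ≤ g 0 := by
      have : Iio (0 : Fin (n + 1)) = ∅ := by
        ext l
        simp
      simp [g, this]
    have hn : g (Fin.last n) ≤ 0 := by
      have h1 : ∑ j, (a j : ℤ) = ∑ l ∈ Iio (Fin.last n), (a (π l) : ℤ) + a (π (Fin.last n)) := by
        rw [← Equiv.sum_comp π]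
        have : (univ : Finset (Fin (n + 1))) = insert (Fin.last n) (Iio (Fin.last n)) := by
          ext l
          have := l.2
          simp only [mem_univ, mem_Iio, mem_insert, Fin.lt_def, Fin.ext_iff, Fin.val_last]
          lia
        rw [this, sum_insert (by simp), add_comm]
      have h2 := hle (π (Fin.last n))
      zify at h2
      simp only [g]
      lia
    exact le_antisymm ((hg (Fin.le_last k)).trans hn) (h0.trans (hg (Fin.zero_le k)))
  -- A descent of `π` would force a strict gap, hence positive slack.
  have hπ : StrictMono π := by
    refine Fin.strictMono_iff_lt_succ.2 fun k ↦ ?_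
    by_contra h
    have hne : π k.succ ≠ π k.castSucc := fun h ↦ Fin.castSucc_lt_succ.ne' (π.injective h)
    have h1 := (hstep k).2 (lt_of_le_of_ne (not_lt.1 h) hne)
    have h2 := hg0 k.castSucc
    have h3 := hg0 k.succ
    simp only [g, hIio] at h2 h3
    lia
  have hid : ∀ k, π k = k := by
    have := Subsingleton.elim (StrictMono.orderIsoOfSurjective π hπ π.surjective)
      (OrderIso.refl _)
    exact fun k ↦ DFunLike.congr_fun this k
  have := hg0 i
  simp only [g, hid] at this
  zify
  lia

/-! ### Splitting and telescoping of `q`-factorials. -/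

section Telescoping

variable {K : Type*} [Field K]

theorem qShiftedFactorial_self_ne_zero {q : K} (hq : ∀ k : ℕ, 0 < k → q ^ k ≠ 1) (m : ℕ) :
    qShiftedFactorial q q m ≠ 0 := by
  refine prod_ne_zero_iff.2 fun k _ ↦ ?_
  rw [← pow_succ]
  exact sub_ne_zero.2 (hq _ k.succ_pos).symm

theorem qShiftedFactorial_self_add (q : K) (m b : ℕ) :
    qShiftedFactorial q q (m + b) =
      qShiftedFactorial q q m * ∏ k ∈ range b, (1 - q ^ ((k : ℤ) + 1 + m)) := by
  rw [qShiftedFactorial, prod_range_add]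
  congr 1
  refine prod_congr rfl fun k _ ↦ ?_
  rw [← pow_succ, ← zpow_natCast]
  congr 2
  push_cast
  ring

theorem qShiftedFactorial_inv_add (q : K) (m b : ℕ) :
    qShiftedFactorial q⁻¹ q⁻¹ (m + b) =
      qShiftedFactorial q⁻¹ q⁻¹ m * ∏ k ∈ range b, (1 - q ^ ((k : ℤ) - (m + b : ℕ))) := by
  rw [qShiftedFactorial, prod_range_add]
  congr 1
  rw [← prod_range_reflect]
  refine prod_congr rfl fun k hk ↦ ?_
  have := mem_range.1 hk
  rw [← pow_succ, inv_pow, ← zpow_natCast, ← zpow_neg]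
  congr 2
  lia

theorem prod_Ico_div_of_ne_zero (f : ℕ → K) (hf : ∀ k, f k ≠ 0) {m n : ℕ} (h : m ≤ n) :
    ∏ k ∈ Ico m n, f (k + 1) / f k = f n / f m := by
  induction n, h using Nat.le_induction with
  | base => simp [hf]
  | succ n hmn ih =>
    rw [prod_Ico_succ_top hmn, ih]
    have := hf n
    field_simp

end Telescoping

/-! ### The weighted value at the surviving point. -/

section FinalEvaluation

variable {K : Type*} [Field K]

theorem qShiftedFactorial_zero_right {R : Type*} [CommRing R] (q z : R) :
    qShiftedFactorial q z 0 = 1 := by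
  rw [qShiftedFactorial, range_zero, prod_empty]

/-- Nodes below `p` give negative powers of `q`, nodes above it positive ones. -/
theorem geometricWeight_add (q : K) (p r : ℕ) :
    geometricWeight q (p + r) p =
      (qShiftedFactorial q⁻¹ q⁻¹ p * qShiftedFactorial q q r)⁻¹ := by
  have hset : (range (p + r + 1)).erase p = range p ∪ Ico (p + 1) (p + r + 1) := by
    ext s
    simp only [mem_erase, mem_union, mem_range, mem_Ico]
    lia
  rw [geometricWeight, prod_inv_distrib, hset, prod_union (by
    rw [disjoint_left]
    intro s hs
    simp only [mem_range, mem_Ico] at hs ⊢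
    lia), prod_Ico_eq_prod_range]
  congr 2
  · have := qShiftedFactorial_inv_add q 0 p
    rw [zero_add, qShiftedFactorial_zero_right, one_mul] at this
    exact this.symm
  · have := qShiftedFactorial_self_add q 0 r
    rw [zero_add, qShiftedFactorial_zero_right, one_mul] at this
    rw [this, show p + r + 1 - (p + 1) = r by lia]
    refine prod_congr rfl fun k _ ↦ ?_
    congr 2
    push_cast
    ring

/-- The first factors telescope over `i` for fixed `j`, the second over `j` for fixed `i`. The
`q⁻¹`-factorials then cancel against the weights, and what remains telescopes once more. -/
theorem prod_pairs_mul_prod_geometricWeight {q : K} (hq : ∀ k : ℕ, 0 < k → q ^ k ≠ 1)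
    (a P : ℕ → ℕ) (hP0 : P 0 = 0) (hP : ∀ k, P (k + 1) = P k + a k) (N : ℕ) :
    (∏ i ∈ range N, geometricWeight q (P N - a i) (P i)) *
      (∏ i ∈ range N, ∏ j ∈ Ico (i + 1) N,
        (∏ k ∈ range (a i), (1 - q ^ ((k : ℤ) + P i - P j))) *
          ∏ k ∈ range (a j), (1 - q ^ ((k : ℤ) + 1 + P j - P i))) =
      qShiftedFactorial q q (P N) / ∏ i ∈ range N, qShiftedFactorial q q (a i) := by
  set T : ℕ → K := qShiftedFactorial q q with hT
  set S : ℕ → K := qShiftedFactorial q⁻¹ q⁻¹ with hS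
  have hT0 : ∀ m, T m ≠ 0 := qShiftedFactorial_self_ne_zero hq
  have hS0 : ∀ m, S m ≠ 0 := qShiftedFactorial_self_ne_zero fun k hk h ↦ hq k hk (by
    rwa [inv_pow, inv_eq_one] at h)
  have hmono : Monotone P := monotone_nat_of_le_succ fun k ↦ by rw [hP]; lia
  have hA : ∀ i j, i < j →
      ∏ k ∈ range (a i), (1 - q ^ ((k : ℤ) + P i - P j)) =
        S (P j - P i) / S (P j - P (i + 1)) := by
    intro i j hij
    have h1 := hmono (Nat.succ_le_of_lt hij)
    have h2 := hP i
    rw [Nat.succ_eq_add_one] at h1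
    rw [eq_div_iff (hS0 _), show P j - P i = P j - P (i + 1) + a i by lia, hS,
      qShiftedFactorial_inv_add, mul_comm]
    congr 1
    refine prod_congr rfl fun k _ ↦ ?_
    congr 2
    lia
  have hB : ∀ i j, i < j →
      ∏ k ∈ range (a j), (1 - q ^ ((k : ℤ) + 1 + P j - P i)) =
        T (P (j + 1) - P i) / T (P j - P i) := by
    intro i j hij
    have h1 := hmono hij.le
    have h2 := hP j
    rw [eq_div_iff (hT0 _), show P (j + 1) - P i = P j - P i + a j by lia, hT,
      qShiftedFactorial_self_add, mul_comm]
    congr 1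
    refine prod_congr rfl fun k _ ↦ ?_
    congr 2
    lia
  have hAprod : ∏ i ∈ range N, ∏ j ∈ Ico (i + 1) N,
      ∏ k ∈ range (a i), (1 - q ^ ((k : ℤ) + P i - P j)) = ∏ j ∈ range N, S (P j) := by
    rw [prod_comm' (t' := range N) (s' := fun j ↦ range j) (by
      intro i j
      simp only [mem_range, mem_Ico]
      lia)]
    refine prod_congr rfl fun j _ ↦ ?_
    rw [prod_congr rfl fun i hi ↦ hA i j (mem_range.1 hi)]
    -- Inverses are used because `P j - P i` decreases as `i` grows.
    have := prod_Ico_div_of_ne_zero (fun i ↦ (S (P j - P i))⁻¹)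
      (fun i ↦ inv_ne_zero (hS0 _)) (Nat.zero_le j)
    simp only [inv_div_inv, hP0, Nat.sub_self, Nat.sub_zero, Nat.Ico_zero_eq_range] at this
    rw [this, hS, qShiftedFactorial_zero_right, div_one]
  have hBprod : ∀ i ∈ range N, ∏ j ∈ Ico (i + 1) N,
      ∏ k ∈ range (a j), (1 - q ^ ((k : ℤ) + 1 + P j - P i)) = T (P N - P i) / T (a i) := by
    intro i hi
    rw [prod_congr rfl fun j hj ↦ hB i j (by have := mem_Ico.1 hj; lia),
      prod_Ico_div_of_ne_zero (fun j ↦ T (P j - P i)) (fun j ↦ hT0 _)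
        (Nat.succ_le_of_lt (mem_range.1 hi)), hP, Nat.add_sub_cancel_left]
  have hW : ∀ i ∈ range N, geometricWeight q (P N - a i) (P i) =
      (S (P i) * T (P N - P (i + 1)))⁻¹ := by
    intro i hi
    have h1 := hmono (Nat.succ_le_of_lt (mem_range.1 hi))
    rw [Nat.succ_eq_add_one, hP] at h1
    rw [show P N - a i = P i + (P N - P (i + 1)) by rw [hP]; lia, geometricWeight_add]
  have htel : ∏ i ∈ range N, T (P N - P i) / T (P N - P (i + 1)) = T (P N) := by
    have := prod_Ico_div_of_ne_zero (fun i ↦ (T (P N - P i))⁻¹)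
      (fun i ↦ inv_ne_zero (hT0 _)) (Nat.zero_le N)
    simp only [inv_div_inv, hP0, Nat.sub_self, Nat.sub_zero, Nat.Ico_zero_eq_range] at this
    rw [this, hT, qShiftedFactorial_zero_right, div_one]
  simp_rw [prod_mul_distrib]
  rw [hAprod, prod_congr rfl hBprod, prod_congr rfl hW, ← mul_assoc, ← prod_mul_distrib,
    ← prod_mul_distrib]
  conv_rhs => rw [← htel, ← prod_div_distrib]
  refine prod_congr rfl fun i _ ↦ ?_
  have := hS0 (P i)
  have := hT0 (P N - P (i + 1))
  have := hT0 (a i)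
  field_simp

theorem prod_Ioi_fin_eq_prod_Ico {M : Type*} [CommMonoid M] {n : ℕ} (f : ℕ → ℕ → M) :
    ∏ i : Fin n, ∏ j ∈ Ioi i, f i j = ∏ i ∈ range n, ∏ j ∈ Ico (i + 1) n, f i j := by
  rw [← Fin.prod_univ_eq_prod_range (fun i ↦ ∏ j ∈ Ico (i + 1) n, f i j)]
  refine prod_congr rfl fun i _ ↦ ?_
  refine prod_bij (fun j _ ↦ (j : ℕ)) ?_ (fun _ _ _ _ h ↦ Fin.ext h) ?_ (fun _ _ ↦ rfl)
  · intro j hj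
    have := j.2
    simp only [mem_Ioi, Fin.lt_def, mem_Ico] at hj ⊢
    lia
  · intro j hj
    rw [mem_Ico] at hj
    exact ⟨⟨j, hj.2⟩, mem_Ioi.2 (Fin.lt_def.2 (Nat.lt_of_succ_le hj.1)), rfl⟩

theorem sum_Iio_fin_eq_sum_range {M : Type*} [AddCommMonoid M] {n : ℕ} (f : ℕ → M) (i : Fin n) :
    ∑ j ∈ Iio i, f j = ∑ j ∈ range i, f j := by
  refine sum_bij (fun j _ ↦ (j : ℕ)) ?_ (fun _ _ _ _ h ↦ Fin.ext h) ?_ (fun _ _ ↦ rfl)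
  · intro j hj
    simpa using hj
  · intro j hj
    rw [mem_range] at hj
    exact ⟨⟨j, hj.trans i.2⟩, mem_Iio.2 (Fin.lt_def.2 hj), rfl⟩

end FinalEvaluation

/-! ### Application to the Dyson product. -/

section DysonProduct

variable {n : ℕ} (a : Fin (n + 1) → ℕ)

/-- The `q`-Dyson product `∏_{i < j} (x_i / x_j)_{a_i} (q x_j / x_i)_{a_j}`. -/
noncomputable def dysonProduct : LaurentRing n :=
  ∏ i : Fin (n + 1), ∏ j ∈ Finset.Ioi i,
    qShiftedFactorial (qConst n) (varRatio i j) (a i) *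
      qShiftedFactorial (qConst n) (varRatio j i * qConst n) (a j)

/-- Each index `j ≠ i` contributes `a j` to the pole order in `x_i`: from the first factor if `j <
i`, from the second if `j > i`. -/
theorem isHomogeneousWithPoles_dysonProduct :
    IsHomogeneousWithPoles (fun i ↦ ∑ j, a j - a i) (dysonProduct a) := by
  classical
  have h := IsHomogeneousWithPoles.prod univ fun i _ ↦
    IsHomogeneousWithPoles.prod (Ioi i) fun j _ ↦
      (isHomogeneousWithPoles_qShiftedFactorial i j (a i) 0).mul
        (isHomogeneousWithPoles_qShiftedFactorial j i (a j) 1)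
  simp only [pow_zero, mul_one, pow_one] at h
  rw [dysonProduct]
  convert h using 1
  ext k
  simp only [Finset.sum_apply, Pi.add_apply, sum_add_distrib, Pi.single_apply]
  have h1 : ∑ i, ∑ j ∈ Ioi i, (if k = j then a i else 0) = ∑ i ∈ Iio k, a i := by
    simp only [sum_ite_eq, mem_Ioi]
    rw [← sum_filter, filter_gt_eq_Iio]
  have h2 : ∑ i, ∑ j ∈ Ioi i, (if k = i then a j else 0) = ∑ j ∈ Ioi k, a j := by
    rw [sum_eq_single k (fun i _ hi ↦ sum_eq_zero fun j _ ↦ if_neg (Ne.symm hi)) (by simp)]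
    simp
  have h3 : (univ : Finset (Fin (n + 1))) = insert k (Iio k ∪ Ioi k) := by
    ext l
    simp only [mem_univ, mem_insert, mem_union, mem_Iio, mem_Ioi, true_iff]
    lia
  have h4 : Disjoint (Iio k) (Ioi k) := by
    rw [disjoint_left]
    intro l h
    simp only [mem_Iio, mem_Ioi] at h ⊢
    lia
  rw [h1, h2, h3, sum_insert (by simp), sum_union h4, Nat.add_sub_cancel_left]

theorem laurentEval_dysonProduct (α : Fin (n + 1) → ℤ) :
    laurentEval α (dysonProduct a) = ∏ i, ∏ j ∈ Ioi i,
      (∏ k ∈ range (a i), (1 - qVar ^ ((k : ℤ) + α i - α j))) *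
        ∏ k ∈ range (a j), (1 - qVar ^ ((k : ℤ) + 1 + α j - α i)) := by
  rw [dysonProduct, map_prod]
  refine prod_congr rfl fun i _ ↦ ?_
  rw [map_prod]
  refine prod_congr rfl fun j _ ↦ ?_
  have h1 := laurentEval_qShiftedFactorial α i j (a i) 0
  have h2 := laurentEval_qShiftedFactorial α j i (a j) 1
  simp only [pow_zero, mul_one, pow_one, Nat.cast_zero, add_zero, Nat.cast_one] at h1 h2
  rw [map_mul, h1, h2]

theorem eq_partialSum_of_laurentEval_dysonProduct_ne_zero (α : Fin (n + 1) → ℕ)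
    (hle : ∀ i, α i + a i ≤ ∑ j, a j)
    (h : laurentEval (fun i ↦ (α i : ℤ)) (dysonProduct a) ≠ 0) (i : Fin (n + 1)) :
    α i = ∑ j ∈ Iio i, a j := by
  rw [laurentEval_dysonProduct, prod_ne_zero_iff] at h
  have h' : ∀ i j, i < j →
      (∀ k < a i, qVar ^ ((k : ℤ) + α i - α j) ≠ 1) ∧
        ∀ k < a j, qVar ^ ((k : ℤ) + 1 + α j - α i) ≠ 1 := by
    intro i j hij
    have := prod_ne_zero_iff.1 (h i (mem_univ i)) j (mem_Ioi.2 hij)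
    rw [mul_ne_zero_iff, prod_ne_zero_iff, prod_ne_zero_iff] at this
    exact ⟨fun k hk ↦ (sub_ne_zero.1 (this.1 k (mem_range.2 hk))).symm,
      fun k hk ↦ (sub_ne_zero.1 (this.2 k (mem_range.2 hk))).symm⟩
  refine eq_partialSum_of_gaps a α hle (fun i j hij hα ↦ ?_) (fun i j hji hα ↦ ?_) i
  · by_contra hlt
    refine (h' i j hij).1 (α j - α i) (by lia) ?_
    rw [show ((α j - α i : ℕ) : ℤ) + α i - α j = 0 by lia, zpow_zero]
  · by_contra hlt
    -- The `- 1` absorbs the extra `q` in the second factor, which is what makes this gap strict.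
    refine (h' j i hji).2 (α j - α i - 1) (by lia) ?_
    rw [show ((α j - α i - 1 : ℕ) : ℤ) + 1 + α i - α j = 0 by lia, zpow_zero]

theorem constantTerm_dysonProduct :
    constantTerm (dysonProduct a) =
      qShiftedFactorial qVar qVar (∑ i, a i) / ∏ i, qShiftedFactorial qVar qVar (a i) := by
  classical
  -- Extension of `a` by 0, so that partial sums and telescoping run over natural numbers.
  let b : ℕ → ℕ := fun k ↦ if h : k < n + 1 then a ⟨k, h⟩ else 0
  have hb : ∀ i : Fin (n + 1), a i = b i := fun i ↦ by
    simp only [b]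
    rw [dif_pos i.2]
  let P : ℕ → ℕ := fun k ↦ ∑ l ∈ range k, b l
  have hP : ∀ i : Fin (n + 1), ∑ j ∈ Iio i, a j = P i := fun i ↦ by
    simp_rw [hb]
    exact sum_Iio_fin_eq_sum_range b i
  have hsum : ∑ i, a i = P (n + 1) := by
    simp_rw [hb]
    exact Fin.sum_univ_eq_sum_range b (n + 1)
  have hPsucc : ∀ k, P (k + 1) = P k + b k := fun k ↦ sum_range_succ b k
  have hmono : Monotone P := monotone_nat_of_le_succ fun k ↦ by rw [hPsucc]; lia
  have ha : ∀ i, a i ≤ ∑ j, a j := fun i ↦ single_le_sum (by simp) (mem_univ i)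
  rw [constantTerm_eq_sum_laurentEval (isHomogeneousWithPoles_dysonProduct a),
    sum_eq_single (fun i : Fin (n + 1) ↦ P i)]
  · have key := prod_pairs_mul_prod_geometricWeight qVar_pow_ne_one b P (by simp [P]) hPsucc (n + 1)
    rw [laurentEval_dysonProduct, hsum]
    simp_rw [hb]
    rw [prod_Ioi_fin_eq_prod_Ico fun i j ↦
        (∏ k ∈ range (b i), (1 - qVar ^ ((k : ℤ) + P i - P j))) *
          ∏ k ∈ range (b j), (1 - qVar ^ ((k : ℤ) + 1 + P j - P i)),
      Fin.prod_univ_eq_prod_range (fun i ↦ geometricWeight qVar (P (n + 1) - b i) (P i)),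
      Fin.prod_univ_eq_prod_range (fun i ↦ qShiftedFactorial qVar qVar (b i)), key]
  · intro α hα hne
    rw [Fintype.mem_piFinset] at hα
    refine mul_eq_zero_of_right _ ?_
    by_contra h
    refine hne (funext fun i ↦ ?_)
    rw [eq_partialSum_of_laurentEval_dysonProduct_ne_zero a α (fun i ↦ ?_) h i, hP]
    have h1 := mem_range.1 (hα i)
    have h2 := ha i
    lia
  · intro hmem
    refine absurd (Fintype.mem_piFinset.2 fun i ↦ mem_range.2 ?_) hmem
    have h1 : P (i + 1) ≤ P (n + 1) := hmono i.2
    rw [hPsucc, ← hb] at h1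
    rw [hsum]
    lia

end DysonProduct

theorem theorem2 (n : ℕ) (a : Fin (n + 1) → ℕ) :
    constantTerm
        (∏ i : Fin (n + 1), ∏ j ∈ Finset.Ioi i,
          qShiftedFactorial (qConst n) (varRatio i j) (a i) *
            qShiftedFactorial (qConst n) (varRatio j i * qConst n) (a j)) =
      qShiftedFactorial qVar qVar (∑ i, a i) / ∏ i, qShiftedFactorial qVar qVar (a i) :=
  constantTerm_dysonProduct a
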